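/- Graphs are finite, undirected and non-empty, and may have multi-edges and multi-loops; every edge (also a loop) of $G=(V,E)$ gives two distinct directed edges $e,\overline e$, inverse to each other, which form the set $\vec E$, and $o(e),t(e)$ are the origin and terminus of $e\in\vec E$. $G$ is $(q+1)$-regular if every vertex is the origin of exactly $q+1$ directed edges. The adjacency matrix is $A_{ij}=\#\{e\in\vec E: o(e)=i,\ t(e)=j\}$. For a subgroup $\mathcal G$ of the unitary group $U(N)$, $N\ge 1$, a $\mathcal G$-color on $G$ is a map $\sigma:\vec E\to\mathcal G$ with $\sigma(\overline e)=\sigma(e)^{-1}$, and $A^\sigma$ is the Hermitian $N|V|\times N|V|$ matrix with $N\times N$ blocks $(A^\sigma)_{ij}=\sum_{e\in\vec E:\,o(e)=i,\,t(e)=j}\sigma(e)$. For a $(q+1)$-regular $G$ with $q\ge 1$, the normalized spectral measures are $$\mu(G)=\frac1{|V|}\sum_{k=1}^{|V|}\delta_{q^{-1/2}\lambda_k(A)},\qquad \mu(G,\sigma)=\frac1{N|V|}\sum_{k=1}^{N|V|}\delta_{q^{-1/2}\lambda_k(A^\sigma)},$$ where $\lambda_k$ denotes the eigenvalues, counted with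 multiplicity. Let $\mu_\infty$ be the semicircle distribution, $d\mu_\infty(x)=\frac1{2\pi}\sqrt{4-x^2}\,\mathbf 1_{|x|\le 2}\,dx$. For $p\in[1,\infty)$ let $P_p(\mathbb R)$ be the set of probability measures on $\mathbb R$ with finite $p$-th moment, with the Wasserstein distance $W_p(\mu,\nu)=\inf_\gamma\big(\int_{\mathbb R^2}|x-y|^p\,d\gamma(x,y)\big)^{1/p}$, the infimum being over all couplings $\gamma$ of $\mu$ and $\nu$. **Corollary.** Let $\{G_n\}_{n=0}^\infty$ be a sequence of graphs, $G_n$ being $(q_n+1)$-regular with $q_n\ge 1$, and for every $n$ let $\mathcal G_n$ be a subgroup of $U(N_n)$, $N_n\ge 1$. Then $\mu(G_n)$ converges to $\mu_\infty$ in $(P_p(\mathbb R),W_p)$ for every $p\in[1,\infty)$ if and only if, for every choice of $\mathcal G_n$-colors $\sigma_n$ on $G_n$ ($n\ge 0$), $\mu(G_n,\sigma_n)$ converges to $\mu_\infty$ in $(P_p(\mathbb R),W_p)$ for every $p\in[1,\infty)$. -/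

import Mathlib

open MeasureTheory Filter Topology
open scoped ENNReal

noncomputable section

/-- A graph with vertex set `V` and set `D` of *directed* edges, multi-edges and multi-loops being
allowed. Every undirected edge, also a loop, gives two distinct directed edges, which are inverse
to each other; the undirected edges are the orbits `{e, inv e}`. -/
structure DirectedEdgeGraph (V D : Type*) where
  /-- the origin `o(e)` -/
  origin : D → V
  /-- the terminus `t(e)` -/
  terminus : D → V
  /-- the inverse edge -/
  inv : D → D
  inv_inv : ∀ e, inv (inv e) = e
  inv_ne : ∀ e, inv e ≠ e
  origin_inv : ∀ e, origin (inv e) = terminus e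

namespace DirectedEdgeGraph

theorem terminus_inv {V D : Type*} (G : DirectedEdgeGraph V D) (e : D) :
    G.terminus (G.inv e) = G.origin e := by
  rw [← G.origin_inv, G.inv_inv]

/-- Inversion as a permutation of the directed edges. -/
def invEquiv {V D : Type*} (G : DirectedEdgeGraph V D) : D ≃ D :=
  ⟨G.inv, G.inv, G.inv_inv, G.inv_inv⟩

/-- The graph is `d`-regular: every vertex is the origin of exactly `d` directed edges
(so a loop contributes `2` to the degree). -/
def IsRegular {V D : Type*} [DecidableEq V] [Fintype D] (G : DirectedEdgeGraph V D) (d : ℕ) :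
    Prop :=
  ∀ v, (Finset.univ.filter fun e => G.origin e = v).card = d

/-- The directed edges from `i` to `j`. -/
def edgesBetween {V D : Type*} [DecidableEq V] [Fintype D] (G : DirectedEdgeGraph V D) (i j : V) :
    Finset D :=
  Finset.univ.filter fun e => G.origin e = i ∧ G.terminus e = j

theorem sum_edgesBetween_swap {V D M : Type*} [DecidableEq V] [Fintype D] [AddCommMonoid M]
    (G : DirectedEdgeGraph V D) (i j : V) (f : D → M) :
    ∑ e ∈ G.edgesBetween j i, f e = ∑ e ∈ G.edgesBetween i j, f (G.inv e) := by
  refine (Finset.sum_equiv G.invEquiv (fun e => ?_) (fun e _ => rfl)).symm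
  simp only [edgesBetween, Finset.mem_filter, Finset.mem_univ, true_and, invEquiv,
    Equiv.coe_fn_mk, G.origin_inv, G.terminus_inv]
  exact and_comm

/-- The adjacency matrix: the entry at `(i, j)` is the number of directed edges from `i` to `j`. -/
def adjMatrix {V D : Type*} [DecidableEq V] [Fintype D] (G : DirectedEdgeGraph V D) :
    Matrix V V ℝ :=
  Matrix.of fun i j => ((G.edgesBetween i j).card : ℝ)

theorem isHermitian_adjMatrix {V D : Type*} [DecidableEq V] [Fintype D]
    (G : DirectedEdgeGraph V D) : G.adjMatrix.IsHermitian := by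
  ext i j
  have h := G.sum_edgesBetween_swap i j (fun _ => (1 : ℝ))
  simpa [adjMatrix] using h

/-- A `H`-color on `G`, for a subgroup `H` of the unitary group `U(N)`: an assignment of an element
of `H` to every directed edge, satisfying the symmetric condition. -/
structure Color {V D : Type*} (G : DirectedEdgeGraph V D) {N : ℕ}
    (H : Subgroup (Matrix.unitaryGroup (Fin N) ℂ)) where
  toFun : D → H
  map_inv : ∀ e, toFun (G.inv e) = (toFun e)⁻¹

/-- The colored adjacency matrix `A^σ`, of size `N|V| × N|V|`: its `N × N` block at `(i, j)` is the
sum of `σ(e)` over the directed edges `e` from `i` to `j`. -/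
def colorMatrix {V D : Type*} [DecidableEq V] [Fintype D] (G : DirectedEdgeGraph V D) {N : ℕ}
    {H : Subgroup (Matrix.unitaryGroup (Fin N) ℂ)} (σ : G.Color H) :
    Matrix (V × Fin N) (V × Fin N) ℂ :=
  Matrix.of fun x y =>
    (∑ e ∈ G.edgesBetween x.1 y.1,
      ((σ.toFun e : Matrix.unitaryGroup (Fin N) ℂ) : Matrix (Fin N) (Fin N) ℂ)) x.2 y.2

theorem isHermitian_colorMatrix {V D : Type*} [DecidableEq V] [Fintype D]
    (G : DirectedEdgeGraph V D) {N : ℕ} {H : Subgroup (Matrix.unitaryGroup (Fin N) ℂ)}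
    (σ : G.Color H) : (G.colorMatrix σ).IsHermitian := by
  ext x y
  simp only [colorMatrix, Matrix.conjTranspose_apply, Matrix.of_apply]
  rw [G.sum_edgesBetween_swap x.1 y.1]
  simp only [Matrix.sum_apply, star_sum]
  refine Finset.sum_congr rfl fun e _ => ?_
  rw [σ.map_inv]
  simp [Matrix.star_apply]

end DirectedEdgeGraph

/-- The empirical spectral distribution of `c • A` for a Hermitian matrix `A` and a real `c`:
the mass `1 / n` at `c * λ`, for each of the `n` eigenvalues `λ` of `A`, with multiplicity. -/
def empiricalSpectralMeasure {𝕜 ι : Type*} [RCLike 𝕜] [Fintype ι] [DecidableEq ι]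
    {A : Matrix ι ι 𝕜} (hA : A.IsHermitian) (c : ℝ) : Measure ℝ :=
  (Fintype.card ι : ℝ≥0∞)⁻¹ • ∑ k, Measure.dirac (c * hA.eigenvalues k)

namespace DirectedEdgeGraph

/-- The normalized spectral measure `μ(G)` of a finite `(q + 1)`-regular graph. -/
def spectralMeasure {V D : Type*} [Fintype V] [DecidableEq V] [Fintype D]
    (G : DirectedEdgeGraph V D) (q : ℕ) : Measure ℝ :=
  empiricalSpectralMeasure G.isHermitian_adjMatrix (Real.sqrt q)⁻¹

/-- The normalized spectral measure `μ(G, σ)` of a finite `(q + 1)`-regular graph with a color. -/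
def colorSpectralMeasure {V D : Type*} [Fintype V] [DecidableEq V] [Fintype D]
    (G : DirectedEdgeGraph V D) (q : ℕ) {N : ℕ} {H : Subgroup (Matrix.unitaryGroup (Fin N) ℂ)}
    (σ : G.Color H) : Measure ℝ :=
  empiricalSpectralMeasure (G.isHermitian_colorMatrix σ) (Real.sqrt q)⁻¹

end DirectedEdgeGraph

/-- The Wigner semicircle distribution, with density `√(4 - x²) / (2π)` on `|x| ≤ 2`. -/
def semicircleLaw : Measure ℝ :=
  volume.withDensity fun x =>
    ENNReal.ofReal (if |x| ≤ 2 then 1 / (2 * Real.pi) * Real.sqrt (4 - x ^ 2) else 0)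

/-- `P_p(ℝ)`: the probability measures on `ℝ` with finite `p`-th moment. -/
def wassersteinSpace (p : ℝ) : Set (Measure ℝ) :=
  {μ | IsProbabilityMeasure μ ∧ ∫⁻ x, ‖x‖ₑ ^ p ∂μ < ∞}

/-- The couplings of two measures on `ℝ`: the measures on `ℝ × ℝ` with the given marginals. -/
def couplings (μ ν : Measure ℝ) : Set (Measure (ℝ × ℝ)) :=
  {γ | γ.map Prod.fst = μ ∧ γ.map Prod.snd = ν}

/-- The Wasserstein distance `W_p` (finite on `P_p(ℝ)`). -/
def wassersteinDist (p : ℝ) (μ ν : Measure ℝ) : ℝ≥0∞ :=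
  ⨅ γ ∈ couplings μ ν, (∫⁻ z, ‖z.1 - z.2‖ₑ ^ p ∂γ) ^ (1 / p)

/-- Convergence in the Wasserstein space `(P_p(ℝ), W_p)`. -/
def ConvergesInWasserstein (p : ℝ) (μ : ℕ → Measure ℝ) (ν : Measure ℝ) : Prop :=
  (∀ n, μ n ∈ wassersteinSpace p) ∧ ν ∈ wassersteinSpace p ∧
    Tendsto (fun n => wassersteinDist p (μ n) ν) atTop (𝓝 0)

end

/-! Write `S_k` for the Chebyshev polynomials with `S_k(2 cos θ) sin θ = sin((k+1)θ)`. In a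
`(q+1)`-regular graph the matrix of non-backtracking walks of length `k ≥ 1`, scaled by `q^{-k/2}`,
is `P_k = S_k - q⁻¹ S_{k-2}` evaluated at the normalized adjacency matrix. The identity uses only
that inverse edges have inverse weights, so it holds for colors too (`aeval_chebyshev_eq_nbMatrix`).
The colored weight of a walk is unitary, hence its trace is at most `N` times the uncolored weight
`1`, and `|∫ P_k dμ(G,σ)| ≤ ∫ P_k dμ(G)` (`abs_integral_colorSpectralMeasure_le`).

Under the semicircle law `S_k` has integral `0` for `k ≥ 1`. If `μ(G_n)` converges, then `∫ S_k
dμ(G_n) → 0`; positivity of `∫ P_2 dμ(G_n)` reads `q_n⁻¹ ≤ ∫ S_2 dμ(G_n)`, so `q_n → ∞`. Hence `∫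
P_k dμ(G_n) → 0`, the domination passes this on to `μ(G_n,σ_n)`, and induction on `k` recovers the
integrals of `S_k`, that is, the moments. Conversely, the trivial color gives `A ⊗ I_N`, whose
spectral measure has the moments of `μ(G_n)`.

The translation between moments and `W_p` uses that the limit has bounded support and no atoms:
moments control characteristic functions, hence distribution functions, hence quantile functions,
which provide a coupling (`convergesInWasserstein_of_tendsto_moments`). The other direction is
`tendsto_moments_of_convergesInWasserstein`. -/

noncomputable section

namespace DirectedEdgeGraph

/-! ### Non-backtracking walks and the Chebyshev recursion -/

section Recursion

variable {V D R : Type*} [DecidableEq V] [Fintype D] [DecidableEq D] [Ring R]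
  (G : DirectedEdgeGraph V D)

/-- The sum of the weights of the non-backtracking walks with `k + 1` edges that start with the
directed edge `e` and end at `j`; the weight of a walk is the product of the weights of its
edges. -/
def nbWalk {V D R : Type*} [DecidableEq V] [Fintype D] [DecidableEq D] [Ring R]
    (G : DirectedEdgeGraph V D) (w : D → R) : ℕ → D → V → R
  | 0, e, j => if G.terminus e = j then w e else 0
  | k + 1, e, j =>
    w e * ∑ f with G.origin f = G.terminus e ∧ f ≠ G.inv e, nbWalk G w k f j

/-- The matrix of weighted sums over the non-backtracking walks with `k + 1` edges. -/
def nbMatrix {V D R : Type*} [DecidableEq V] [Fintype D] [DecidableEq D] [Ring R]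
    (G : DirectedEdgeGraph V D) (w : D → R) (k : ℕ) : Matrix V V R :=
  Matrix.of fun i j => ∑ e with G.origin e = i, G.nbWalk w k e j

theorem nbMatrix_zero_apply (w : D → R) (i j : V) :
    G.nbMatrix w 0 i j = ∑ e ∈ G.edgesBetween i j, w e := by
  simp only [nbMatrix, nbWalk, Matrix.of_apply, edgesBetween]
  rw [← Finset.filter_filter, Finset.sum_filter (p := fun e => G.terminus e = j)]

theorem sum_origin_eq_sum_add (e : D) (g : D → R) :
    ∑ f with G.origin f = G.terminus e, g f
      = (∑ f with G.origin f = G.terminus e ∧ f ≠ G.inv e, g f) + g (G.inv e) := by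
  have h : G.inv e ∈ Finset.univ.filter fun f => G.origin f = G.terminus e := by
    simp [G.origin_inv]
  rw [← Finset.sum_erase_add _ _ h]
  congr 1
  refine Finset.sum_congr ?_ fun _ _ => rfl
  ext f
  simp [and_comm]

variable [Fintype V]

theorem nbMatrix_zero_mul_apply (w : D → R) (M : Matrix V V R) (i j : V) :
    (G.nbMatrix w 0 * M) i j = ∑ e with G.origin e = i, w e * M (G.terminus e) j := by
  simp only [Matrix.mul_apply, nbMatrix, nbWalk, Matrix.of_apply, Finset.sum_mul]
  rw [Finset.sum_comm]
  refine Finset.sum_congr rfl fun e _ => ?_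
  simp [ite_mul]

/-- An edge `e` put in front of a non-backtracking walk either extends it without backtracking or
meets a walk that starts with `G.inv e`; the last sum collects the second case. -/
theorem nbMatrix_zero_mul_nbMatrix (w : D → R) (k : ℕ) (i j : V) :
    (G.nbMatrix w 0 * G.nbMatrix w k) i j
      = G.nbMatrix w (k + 1) i j + ∑ e with G.origin e = i, w e * G.nbWalk w k (G.inv e) j := by
  rw [nbMatrix_zero_mul_apply]
  simp only [nbMatrix, Matrix.of_apply]
  refine Eq.trans ?_ Finset.sum_add_distrib
  refine Finset.sum_congr rfl fun e _ => ?_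
  rw [nbWalk, ← mul_add, sum_origin_eq_sum_add]

variable {w : D → R}

theorem nbMatrix_zero_mul_nbMatrix_zero (hw : ∀ e, w e * w (G.inv e) = 1) {q : ℕ}
    (hG : G.IsRegular (q + 1)) :
    G.nbMatrix w 0 * G.nbMatrix w 0 = G.nbMatrix w 1 + (q + 1) • (1 : Matrix V V R) := by
  ext i j
  rw [nbMatrix_zero_mul_nbMatrix, Matrix.add_apply]
  congr 1
  rw [Finset.sum_congr rfl (g := fun e => (1 : Matrix V V R) i j)]
  · rw [Finset.sum_const, hG i]; rfl
  · intro e he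
    obtain rfl : G.origin e = i := by simpa using he
    simp [nbWalk, G.terminus_inv, Matrix.one_apply, mul_ite, hw]

/-- After a backtrack the weights of `e` and `G.inv e` cancel, leaving a walk from `i` whose first
edge is not `e`. Each walk from `i` so arises from all `q + 1` choices of `e` but one, hence the
factor `q`. -/
theorem nbMatrix_zero_mul_nbMatrix_succ (hw : ∀ e, w e * w (G.inv e) = 1) {q : ℕ}
    (hG : G.IsRegular (q + 1)) (k : ℕ) :
    G.nbMatrix w 0 * G.nbMatrix w (k + 1) = G.nbMatrix w (k + 2) + q • G.nbMatrix w k := by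
  ext i j
  rw [nbMatrix_zero_mul_nbMatrix, Matrix.add_apply]
  congr 1
  have key : ∀ e ∈ Finset.univ.filter (fun e => G.origin e = i),
      w e * G.nbWalk w (k + 1) (G.inv e) j = G.nbMatrix w k i j - G.nbWalk w k e j := by
    intro e he
    obtain rfl : G.origin e = i := by simpa using he
    rw [nbWalk, ← mul_assoc, hw, one_mul, eq_sub_iff_add_eq]
    have h := G.sum_origin_eq_sum_add (G.inv e) (fun f => G.nbWalk w k f j)
    rw [G.inv_inv, G.terminus_inv] at h
    simp only [G.terminus_inv, G.inv_inv, nbMatrix, Matrix.of_apply]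
    exact h.symm
  rw [Finset.sum_congr rfl key, Finset.sum_sub_distrib, Finset.sum_const, hG i,
    Matrix.smul_apply, add_smul, one_smul]
  exact add_sub_cancel_right _ _

-- Both sides satisfy the same three-term recursion, as the scaling turns the factor `q` into `1`.
-- Index `k` belongs to walks of length `k + 1`, so the case `k = 0` uses `S_{-1} = 0`; the case `k
-- = 1` absorbs the exceptional factor `q + 1`.
open Polynomial in
theorem aeval_chebyshev_eq_nbMatrix [Algebra ℝ R] (hw : ∀ e, w e * w (G.inv e) = 1) {q : ℕ}
    (hq : 1 ≤ q) (hG : G.IsRegular (q + 1)) (k : ℕ) :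
    aeval ((Real.sqrt q)⁻¹ • G.nbMatrix w 0)
        (Chebyshev.S ℝ (k + 1) - C (q : ℝ)⁻¹ * Chebyshev.S ℝ (k - 1))
      = (Real.sqrt q)⁻¹ ^ (k + 1) • G.nbMatrix w k := by
  have hq0 : (0 : ℝ) < q := by exact_mod_cast hq
  set c : ℝ := (Real.sqrt q)⁻¹ with hc
  have hcq : c ^ 2 * q = 1 := by
    rw [hc, inv_pow, Real.sq_sqrt hq0.le, inv_mul_cancel₀ hq0.ne']
  induction k using Nat.twoStepInduction with
  | zero => simp
  | one =>
    have hc2 : c ^ 2 = (q : ℝ)⁻¹ := eq_inv_of_mul_eq_one_left hcq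
    have h := G.nbMatrix_zero_mul_nbMatrix_zero hw hG
    rw [← sub_eq_iff_eq_add] at h
    rw [← h]
    norm_num [Chebyshev.S_two]
    rw [_root_.smul_pow, hc2, smul_sub, sq, sub_sub]
    congr 1
    have h1 : (q : Matrix V V R) = (q : ℝ) • (1 : Matrix V V R) := by
      rw [Nat.cast_smul_eq_nsmul, nsmul_one]
    rw [Algebra.algebraMap_eq_smul_one, smul_add, h1, smul_smul, inv_mul_cancel₀ hq0.ne',
      one_smul, add_comm]
  | more k ih1 ih2 =>
    have h := G.nbMatrix_zero_mul_nbMatrix_succ hw hG k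
    rw [← sub_eq_iff_eq_add] at h
    have e1 := Chebyshev.S_add_two ℝ (k + 1)
    have e2 := Chebyshev.S_add_two ℝ (k - 1)
    have e : (Chebyshev.S ℝ ((k + 2 : ℕ) + 1) - C (q : ℝ)⁻¹ * Chebyshev.S ℝ ((k + 2 : ℕ) - 1))
        = X * (Chebyshev.S ℝ ((k + 1 : ℕ) + 1) - C (q : ℝ)⁻¹ * Chebyshev.S ℝ ((k + 1 : ℕ) - 1))
          - (Chebyshev.S ℝ (k + 1) - C (q : ℝ)⁻¹ * Chebyshev.S ℝ (k - 1)) := by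
      push_cast
      ring_nf at e1 e2 ⊢
      rw [e1, e2]
      ring
    rw [e, map_sub, map_mul, ih1, ih2, aeval_X, ← h, smul_sub, smul_mul_smul_comm, ← pow_succ']
    congr 1
    rw [← Nat.cast_smul_eq_nsmul ℝ, smul_smul]
    congr 1
    rw [pow_add c (k + 1) 2, mul_assoc, hcq, mul_one]

end Recursion

/-! ### Colored walks are dominated by uncolored ones -/

section Domination

variable {V D : Type*} [DecidableEq V] [Fintype D] [DecidableEq D] {N : ℕ}
  (G : DirectedEdgeGraph V D)

/-- `U` stands for the product of the weights of the edges already traversed, which lets the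
induction move along the walk. In the end every walk contributes the trace of a unitary matrix. -/
theorem norm_trace_mul_nbWalk_le {w : D → Matrix (Fin N) (Fin N) ℂ}
    (hw : ∀ e, w e ∈ Matrix.unitaryGroup (Fin N) ℂ) (k : ℕ) (e : D) (j : V)
    {U : Matrix (Fin N) (Fin N) ℂ} (hU : U ∈ Matrix.unitaryGroup (Fin N) ℂ) :
    ‖(U * G.nbWalk w k e j).trace‖ ≤ N * G.nbWalk (fun _ => (1 : ℝ)) k e j := by
  induction k generalizing e U with
  | zero =>
    simp only [nbWalk]
    split_ifs
    · refine (norm_sum_le _ _).trans ?_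
      refine (Finset.sum_le_sum fun i _ =>
        entry_norm_bound_of_unitary (mul_mem hU (hw e)) i i).trans ?_
      simp
    · simp
  | succ k ih =>
    simp only [nbWalk, one_mul]
    rw [← mul_assoc, Finset.mul_sum, Matrix.trace_sum, Finset.mul_sum]
    exact (norm_sum_le _ _).trans (Finset.sum_le_sum fun f _ => ih f (mul_mem hU (hw e)))

theorem norm_trace_nbMatrix_le {w : D → Matrix (Fin N) (Fin N) ℂ}
    (hw : ∀ e, w e ∈ Matrix.unitaryGroup (Fin N) ℂ) (k : ℕ) (i j : V) :
    ‖(G.nbMatrix w k i j).trace‖ ≤ N * G.nbMatrix (fun _ => (1 : ℝ)) k i j := by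
  simp only [nbMatrix, Matrix.of_apply]
  rw [Matrix.trace_sum, Finset.mul_sum]
  refine (norm_sum_le _ _).trans (Finset.sum_le_sum fun f _ => ?_)
  simpa using G.norm_trace_mul_nbWalk_le hw k f j (one_mem _)

end Domination

end DirectedEdgeGraph

/-! ### Polynomial integrals as normalized traces -/

section Spectral

open Polynomial

variable {𝕜 ι : Type*} [RCLike 𝕜] [Fintype ι] [DecidableEq ι] {A : Matrix ι ι 𝕜}

theorem Matrix.IsHermitian.trace_pow_eq_sum_eigenvalues (hA : A.IsHermitian) (n : ℕ) :
    (A ^ n).trace = ((∑ k, hA.eigenvalues k ^ n : ℝ) : 𝕜) := by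
  conv_lhs => rw [hA.spectral_theorem]
  rw [← map_pow, Unitary.conjStarAlgAut_apply, Matrix.trace_mul_cycle, Matrix.diagonal_pow]
  simp [Matrix.trace]

theorem Matrix.IsHermitian.trace_aeval (hA : A.IsHermitian) (P : ℝ[X]) :
    (aeval A P).trace = ((∑ k, P.eval (hA.eigenvalues k) : ℝ) : 𝕜) := by
  induction P using Polynomial.induction_on' with
  | add p q hp hq => simp [hp, hq, Finset.sum_add_distrib]
  | monomial n a =>
    rw [aeval_monomial, ← Algebra.smul_def, Matrix.trace_smul, hA.trace_pow_eq_sum_eigenvalues]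
    simp [Finset.mul_sum, Algebra.smul_def]

theorem isProbabilityMeasure_empiricalSpectralMeasure [Nonempty ι] (hA : A.IsHermitian) (c : ℝ) :
    IsProbabilityMeasure (empiricalSpectralMeasure hA c) := by
  constructor
  simp [empiricalSpectralMeasure, ENNReal.inv_mul_cancel]

theorem empiricalSpectralMeasure_mem_wassersteinSpace [Nonempty ι] (hA : A.IsHermitian) (c : ℝ)
    {p : ℝ} (hp : 1 ≤ p) : empiricalSpectralMeasure hA c ∈ wassersteinSpace p := by
  refine ⟨isProbabilityMeasure_empiricalSpectralMeasure hA c, ?_⟩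
  rw [empiricalSpectralMeasure, lintegral_smul_measure, lintegral_finsetSum_measure]
  refine ENNReal.mul_lt_top (by simp [Fintype.card_pos]) (ENNReal.sum_lt_top.2 fun k _ => ?_)
  rw [lintegral_dirac]
  exact ENNReal.rpow_lt_top_of_nonneg (by linarith) enorm_ne_top

theorem integral_empiricalSpectralMeasure (hA : A.IsHermitian) (c : ℝ) (P : ℝ[X]) :
    ((∫ x, P.eval x ∂empiricalSpectralMeasure hA c : ℝ) : 𝕜)
      = (Fintype.card ι : 𝕜)⁻¹ * (aeval (c • A) P).trace := by
  rw [empiricalSpectralMeasure, integral_smul_measure, integral_finsetSum_measure]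
  · have h : aeval (c • A) P = aeval A (P.comp (C c * X)) := by
      rw [aeval_comp]
      simp [Algebra.algebraMap_eq_smul_one]
    rw [h, hA.trace_aeval]
    simp
  · intro k _
    exact integrable_dirac (by simp)

end Spectral

namespace DirectedEdgeGraph

open Polynomial

/-! ### Comparison of colored and uncolored spectral measures -/

section ColorWeight

variable {V D : Type*} [DecidableEq V] [Fintype D] [DecidableEq D]
  (G : DirectedEdgeGraph V D)

theorem adjMatrix_eq_nbMatrix : G.adjMatrix = G.nbMatrix (fun _ => (1 : ℝ)) 0 := by
  ext i j
  simp [nbMatrix_zero_apply, adjMatrix]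

variable {N : ℕ} {H : Subgroup (Matrix.unitaryGroup (Fin N) ℂ)}

/-- A color as a matrix-valued weight on the directed edges. -/
def Color.weight {V D : Type*} {G : DirectedEdgeGraph V D} {N : ℕ}
    {H : Subgroup (Matrix.unitaryGroup (Fin N) ℂ)} (σ : G.Color H) (e : D) :
    Matrix (Fin N) (Fin N) ℂ :=
  ((σ.toFun e : Matrix.unitaryGroup (Fin N) ℂ) : Matrix (Fin N) (Fin N) ℂ)

/-- The color that is the identity on every edge. -/
def trivialColor {V D : Type*} (G : DirectedEdgeGraph V D) {N : ℕ}
    (H : Subgroup (Matrix.unitaryGroup (Fin N) ℂ)) : G.Color H :=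
  ⟨fun _ => 1, fun _ => by simp⟩

theorem Color.weight_mem {V D : Type*} {G : DirectedEdgeGraph V D} (σ : G.Color H) (e : D) :
    σ.weight e ∈ Matrix.unitaryGroup (Fin N) ℂ :=
  (σ.toFun e : Matrix.unitaryGroup (Fin N) ℂ).2

theorem Color.weight_mul_weight_inv {V D : Type*} {G : DirectedEdgeGraph V D} (σ : G.Color H)
    (e : D) : σ.weight e * σ.weight (G.inv e) = 1 := by
  have h : ((σ.toFun e * σ.toFun (G.inv e) : H) : Matrix.unitaryGroup (Fin N) ℂ) = 1 := by
    rw [σ.map_inv, mul_inv_cancel]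
    rfl
  exact congrArg Subtype.val h

/-- The recursion takes place in `V × V` matrices over the ring of `N × N` matrices; flattening the
blocks is an algebra isomorphism, so polynomials and traces transfer. -/
theorem colorMatrix_eq_comp (σ : G.Color H) :
    G.colorMatrix σ = Matrix.comp V V (Fin N) (Fin N) ℂ (G.nbMatrix σ.weight 0) := by
  ext ⟨i, a⟩ ⟨j, b⟩
  rw [Matrix.comp_apply, nbMatrix_zero_apply]
  rfl

theorem nbMatrix_trivialColor :
    G.nbMatrix (trivialColor G H).weight 0
      = (G.nbMatrix (fun _ => (1 : ℝ)) 0).map (algebraMap ℝ (Matrix (Fin N) (Fin N) ℂ)) := by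
  ext1 i j
  rw [Matrix.map_apply, nbMatrix_zero_apply, nbMatrix_zero_apply, map_sum]
  simp [trivialColor, Color.weight]

variable [Fintype V]

theorem _root_.Matrix.trace_comp {V W R : Type*} [Fintype V] [Fintype W] [AddCommMonoid R]
    (M : Matrix V V (Matrix W W R)) :
    (Matrix.comp V V W W R M).trace = ∑ i, (M i i).trace := by
  simp [Matrix.trace, Fintype.sum_prod_type]

theorem trace_aeval_colorMatrix (σ : G.Color H) (c : ℝ) (P : ℝ[X]) :
    (aeval (c • G.colorMatrix σ) P).trace
      = ∑ i, (aeval (c • G.nbMatrix σ.weight 0) P i i).trace := by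
  have h := aeval_algHom_apply (Matrix.compAlgEquiv V (Fin N) ℂ ℝ).toAlgHom
    (c • G.nbMatrix σ.weight 0) P
  rw [map_smul] at h
  rw [← Matrix.trace_comp, colorMatrix_eq_comp]
  exact congrArg Matrix.trace h

theorem integral_spectralMeasure (q : ℕ) (P : ℝ[X]) :
    ∫ x, P.eval x ∂G.spectralMeasure q
      = (Fintype.card V : ℝ)⁻¹
        * (aeval ((Real.sqrt q)⁻¹ • G.nbMatrix (fun _ => (1 : ℝ)) 0) P).trace := by
  have h := integral_empiricalSpectralMeasure G.isHermitian_adjMatrix (Real.sqrt q)⁻¹ P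
  simp only [← adjMatrix_eq_nbMatrix]
  exact h

theorem integral_colorSpectralMeasure (σ : G.Color H) (q : ℕ) (P : ℝ[X]) :
    ((∫ x, P.eval x ∂G.colorSpectralMeasure q σ : ℝ) : ℂ)
      = ((Fintype.card V : ℂ) * N)⁻¹
        * ∑ i, (aeval ((Real.sqrt q)⁻¹ • G.nbMatrix σ.weight 0) P i i).trace := by
  have h := integral_empiricalSpectralMeasure (G.isHermitian_colorMatrix σ) (Real.sqrt q)⁻¹ P
  rw [trace_aeval_colorMatrix] at h
  simpa [colorSpectralMeasure] using h

theorem integral_colorSpectralMeasure_trivialColor (hN : 1 ≤ N) (q : ℕ) (P : ℝ[X]) :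
    ∫ x, P.eval x ∂G.colorSpectralMeasure q (trivialColor G H)
      = ∫ x, P.eval x ∂G.spectralMeasure q := by
  have hN0 : (N : ℂ) ≠ 0 := by exact_mod_cast (by omega : N ≠ 0)
  rw [← Complex.ofReal_inj, integral_colorSpectralMeasure, integral_spectralMeasure,
    nbMatrix_trivialColor]
  set A := G.nbMatrix (fun _ => (1 : ℝ)) 0
  have h := aeval_algHom_apply (Algebra.ofId ℝ (Matrix (Fin N) (Fin N) ℂ)).mapMatrix
    ((Real.sqrt q)⁻¹ • A) P
  rw [map_smul] at h
  have h2 : ∀ i, (aeval ((Real.sqrt q)⁻¹ • A.map (algebraMap ℝ (Matrix (Fin N) (Fin N) ℂ))) P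
      i i).trace = N * (aeval ((Real.sqrt q)⁻¹ • A) P i i : ℝ) := by
    intro i
    refine (congrArg (fun M => (M i i).trace) h).trans ?_
    simp [Algebra.ofId_apply, Matrix.trace, Matrix.algebraMap_matrix_apply]
  rw [Finset.sum_congr rfl fun i _ => h2 i, ← Finset.mul_sum]
  simp only [Matrix.trace, Matrix.diag_apply]
  push_cast
  field_simp

/-- The Chebyshev-type polynomials that evaluate, at the normalized adjacency matrix, to the
normalized matrices of non-backtracking walks, have smaller integrals for colored graphs. -/
theorem abs_integral_colorSpectralMeasure_le (σ : G.Color H) (hN : 1 ≤ N) {q : ℕ} (hq : 1 ≤ q)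
    (hG : G.IsRegular (q + 1)) (k : ℕ) :
    |∫ x, (Chebyshev.S ℝ (k + 1) - C (q : ℝ)⁻¹ * Chebyshev.S ℝ (k - 1)).eval x
        ∂G.colorSpectralMeasure q σ|
      ≤ ∫ x, (Chebyshev.S ℝ (k + 1) - C (q : ℝ)⁻¹ * Chebyshev.S ℝ (k - 1)).eval x
        ∂G.spectralMeasure q := by
  have hN0 : (N : ℝ) ≠ 0 := by exact_mod_cast (by omega : N ≠ 0)
  -- The walk identity is used twice, with matrix weights `σ` and with the real weight `1`.
  rw [← Real.norm_eq_abs, ← Complex.norm_real, integral_colorSpectralMeasure,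
    integral_spectralMeasure, G.aeval_chebyshev_eq_nbMatrix σ.weight_mul_weight_inv hq hG,
    G.aeval_chebyshev_eq_nbMatrix (by simp) hq hG]
  have hc : 0 ≤ (Real.sqrt q)⁻¹ ^ (k + 1) := by positivity
  simp only [Matrix.smul_apply, Matrix.trace_smul, ← Finset.smul_sum, norm_mul, norm_smul]
  have h : ‖∑ i, (G.nbMatrix σ.weight k i i).trace‖
      ≤ N * (G.nbMatrix (fun _ => (1 : ℝ)) k).trace := by
    rw [Matrix.trace, Finset.mul_sum]
    exact (norm_sum_le _ _).trans
      (Finset.sum_le_sum fun i _ => G.norm_trace_nbMatrix_le σ.weight_mem k i i)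
  calc _ ≤ ‖((Fintype.card V : ℂ) * N)⁻¹‖ * (‖(Real.sqrt q)⁻¹ ^ (k + 1)‖
        * (N * (G.nbMatrix (fun _ => (1 : ℝ)) k).trace)) := by gcongr
    _ = _ := by
      rw [Real.norm_of_nonneg hc]
      simp only [norm_inv, norm_mul, Complex.norm_natCast, smul_eq_mul]
      field_simp

end ColorWeight

end DirectedEdgeGraph

/-! ### Taylor expansion of characteristic functions -/

/-- The derivative of each Taylor remainder is `s` times the previous one, so the bound integrates
up from `‖exp (s * x)‖ = 1`. The values `s = ±I` cover both signs of the real argument. -/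
theorem Complex.norm_exp_mul_sub_sum_le {s : ℂ} (hs : s.re = 0) (hs1 : ‖s‖ = 1) (n : ℕ) {x : ℝ}
    (hx : 0 ≤ x) :
    ‖Complex.exp (s * x) - ∑ k ∈ Finset.range n, (s * x) ^ k / (k.factorial : ℂ)‖
      ≤ x ^ n / n.factorial := by
  induction n generalizing x with
  | zero => simp [Complex.norm_exp, hs]
  | succ n ih =>
    have hd : ∀ y : ℝ, HasDerivAt (fun y : ℝ => Complex.exp (s * y)
        - ∑ k ∈ Finset.range (n + 1), (s * y) ^ k / (k.factorial : ℂ))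
        (s * (Complex.exp (s * y) - ∑ k ∈ Finset.range n, (s * y) ^ k / (k.factorial : ℂ))) y := by
      intro y
      have h1 : HasDerivAt (fun y : ℝ => s * (y : ℂ)) s y := by
        simpa using (Complex.ofRealCLM.hasDerivAt (x := y)).const_mul s
      have h2 : HasDerivAt (fun y : ℝ => ∑ k ∈ Finset.range (n + 1),
          (s * y) ^ k / (k.factorial : ℂ))
          (∑ k ∈ Finset.range (n + 1), (k * (s * y) ^ (k - 1) * s) / (k.factorial : ℂ)) y :=
        HasDerivAt.fun_sum fun k _ => (h1.fun_pow k).div_const _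
      refine (h1.cexp.sub h2).congr_deriv ?_
      symm
      rw [mul_sub, mul_comm s, Finset.sum_range_succ', Finset.mul_sum]
      congr 1
      simp only [Nat.cast_zero, zero_mul, zero_div, add_zero]
      refine Finset.sum_congr rfl fun k _ => ?_
      rw [Nat.factorial_succ]
      have : (k.factorial : ℂ) ≠ 0 := by exact_mod_cast k.factorial_ne_zero
      have : (k + 1 : ℂ) ≠ 0 := by exact_mod_cast k.succ_ne_zero
      push_cast
      field_simp
    have hB : ∀ y : ℝ, HasDerivAt (fun y : ℝ => y ^ (n + 1) / (n + 1).factorial)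
        (y ^ n / n.factorial) y := by
      intro y
      refine ((hasDerivAt_pow (n + 1) y).div_const ((n + 1).factorial : ℝ)).congr_deriv ?_
      rw [Nat.factorial_succ]
      have : (n.factorial : ℝ) ≠ 0 := by exact_mod_cast n.factorial_ne_zero
      push_cast
      field_simp
    refine image_norm_le_of_norm_deriv_right_le_deriv_boundary (a := 0) (b := x)
      (fun y _ => (hd y).continuousAt.continuousWithinAt)
      (fun y _ => (hd y).hasDerivWithinAt) ?_ hB ?_ ⟨hx, le_rfl⟩
    · simp [Finset.sum_range_succ']
    · intro y hy
      rw [norm_mul, hs1, one_mul]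
      exact ih hy.1

theorem Complex.norm_exp_I_mul_sub_sum_le (n : ℕ) (x : ℝ) :
    ‖Complex.exp (Complex.I * x)
        - ∑ k ∈ Finset.range n, (Complex.I * x) ^ k / (k.factorial : ℂ)‖
      ≤ |x| ^ n / n.factorial := by
  rcases le_total 0 x with hx | hx
  · simpa [abs_of_nonneg hx] using
      Complex.norm_exp_mul_sub_sum_le (s := Complex.I) (by simp) (by simp) n hx
  · simpa [abs_of_nonpos hx] using
      Complex.norm_exp_mul_sub_sum_le (s := -Complex.I) (by simp) (by simp) n (neg_nonneg.2 hx)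

/-- The even order makes the error bound a moment rather than an absolute moment. -/
theorem norm_charFun_sub_sum_moments_le {μ : Measure ℝ} [IsProbabilityMeasure μ]
    (hμ : ∀ k : ℕ, Integrable (fun x : ℝ => x ^ k) μ) (t : ℝ) (m : ℕ) :
    ‖charFun μ t - ∑ k ∈ Finset.range (2 * m),
        (Complex.I * t) ^ k / (k.factorial : ℂ) * ((∫ x, x ^ k ∂μ : ℝ) : ℂ)‖
      ≤ t ^ (2 * m) / (2 * m).factorial * ∫ x, x ^ (2 * m) ∂μ := by
  have hterm : ∀ k : ℕ, Integrable
      (fun x : ℝ => (Complex.I * t) ^ k / (k.factorial : ℂ) * ((x ^ k : ℝ) : ℂ)) μ :=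
    fun k => ((hμ k).ofReal (𝕜 := ℂ)).const_mul _
  have hexp : Integrable (fun x : ℝ => Complex.exp (t * x * Complex.I)) μ := by
    refine (integrable_const (1 : ℝ)).mono' (by fun_prop) (ae_of_all _ fun x => ?_)
    rw [← Complex.ofReal_mul, Complex.norm_exp_ofReal_mul_I]
  have hsum : ∑ k ∈ Finset.range (2 * m),
      (Complex.I * t) ^ k / (k.factorial : ℂ) * ((∫ x, x ^ k ∂μ : ℝ) : ℂ)
      = ∫ x, ∑ k ∈ Finset.range (2 * m),
        (Complex.I * t) ^ k / (k.factorial : ℂ) * ((x ^ k : ℝ) : ℂ) ∂μ := by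
    rw [integral_finsetSum _ fun k _ => hterm k]
    refine Finset.sum_congr rfl fun k _ => ?_
    rw [integral_const_mul]
    exact congrArg _ integral_ofReal.symm
  rw [charFun_apply_real, hsum, ← integral_sub hexp (integrable_finsetSum _ fun k _ => hterm k),
    ← integral_const_mul]
  refine norm_integral_le_of_norm_le ((hμ (2 * m)).const_mul _) (ae_of_all _ fun x => ?_)
  have h := Complex.norm_exp_I_mul_sub_sum_le (2 * m) (t * x)
  rw [(even_two_mul m).pow_abs] at h
  convert h using 1
  · congr 1
    push_cast
    congr 1
    · ring_nf
    · refine Finset.sum_congr rfl fun k _ => ?_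
      rw [← mul_assoc, mul_pow, mul_pow _ (x : ℂ)]
      ring
  · rw [mul_pow]
    ring

theorem abs_moment_le {ν : Measure ℝ} [IsProbabilityMeasure ν] {R : ℝ}
    (hR : ∀ᵐ x ∂ν, |x| ≤ R) (k : ℕ) : |∫ x, x ^ k ∂ν| ≤ R ^ k := by
  rw [← Real.norm_eq_abs]
  refine (norm_integral_le_of_norm_le_const (C := R ^ k) ?_).trans (by simp)
  filter_upwards [hR] with x hx
  rw [norm_pow, Real.norm_eq_abs]
  gcongr

/-- Method of moments for a limit of bounded support. -/
theorem tendsto_charFun_of_tendsto_moments {μ : ℕ → Measure ℝ} {ν : Measure ℝ}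
    [∀ n, IsProbabilityMeasure (μ n)] [IsProbabilityMeasure ν] {R : ℝ}
    (hμ : ∀ n, ∀ k : ℕ, Integrable (fun x : ℝ => x ^ k) (μ n)) (hR : ∀ᵐ x ∂ν, |x| ≤ R)
    (h : ∀ k : ℕ, Tendsto (fun n => ∫ x, x ^ k ∂μ n) atTop (𝓝 (∫ x, x ^ k ∂ν))) (t : ℝ) :
    Tendsto (fun n => charFun (μ n) t) atTop (𝓝 (charFun ν t)) := by
  have hν : ∀ k : ℕ, Integrable (fun x : ℝ => x ^ k) ν := by
    intro k
    refine (integrable_const (R ^ k)).mono' (by fun_prop) ?_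
    filter_upwards [hR] with x hx
    rw [norm_pow, Real.norm_eq_abs]
    gcongr
  let T : Measure ℝ → ℕ → ℂ := fun μ m => ∑ k ∈ Finset.range (2 * m),
    (Complex.I * t) ^ k / (k.factorial : ℂ) * ((∫ x, x ^ k ∂μ : ℝ) : ℂ)
  have hT : ∀ m, Tendsto (fun n => T (μ n) m) atTop (𝓝 (T ν m)) := fun m =>
    tendsto_finsetSum _ fun k _ =>
      ((Complex.continuous_ofReal.tendsto _).comp (h k)).const_mul _
  rw [Metric.tendsto_atTop']
  intro ε hε
  -- The factor `2` counts the remainders of `μ n` and of `ν`: by convergence of the moment of order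
  -- `2 * m`, the bound for the former tends to the bound for the latter, which bounded support
  -- makes small.
  have hfac : Tendsto (fun m : ℕ => 2 * ((R * t) ^ (2 * m) / (2 * m).factorial)) atTop (𝓝 0) := by
    have := (FloorSemiring.tendsto_pow_div_factorial_atTop (R * t)).comp
      (tendsto_id.const_mul_atTop' (r := 2) (by norm_num))
    simpa using this.const_mul 2
  obtain ⟨m, hm⟩ := (hfac.eventually (gt_mem_nhds hε)).exists
  set a : ℝ := t ^ (2 * m) / (2 * m).factorial with ha
  have ha0 : 0 ≤ a := by
    have := (even_two_mul m).pow_nonneg t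
    positivity
  have hlim : Tendsto (fun n => a * (∫ x, x ^ (2 * m) ∂μ n) + ‖T (μ n) m - T ν m‖
      + a * ∫ x, x ^ (2 * m) ∂ν) atTop
      (𝓝 (a * (∫ x, x ^ (2 * m) ∂ν) + ‖T ν m - T ν m‖ + a * ∫ x, x ^ (2 * m) ∂ν)) :=
    (((h (2 * m)).const_mul a).add ((hT m).sub_const _).norm).add_const _
  have hlt : a * (∫ x, x ^ (2 * m) ∂ν) + ‖T ν m - T ν m‖ + a * ∫ x, x ^ (2 * m) ∂ν < ε := by
    refine lt_of_le_of_lt ?_ hm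
    have h1 := mul_le_mul_of_nonneg_left ((le_abs_self _).trans (abs_moment_le hR (2 * m))) ha0
    have h2 : (R * t) ^ (2 * m) / (2 * m).factorial = a * R ^ (2 * m) := by
      rw [ha, mul_pow]
      ring
    rw [h2, sub_self, norm_zero]
    linarith
  obtain ⟨n₀, hn₀⟩ := eventually_atTop.1 (hlim.eventually (gt_mem_nhds hlt))
  refine ⟨n₀, fun n hn => lt_of_le_of_lt ?_ (hn₀ n hn.le)⟩
  rw [dist_eq_norm]
  have e : charFun (μ n) t - charFun ν t
      = (charFun (μ n) t - T (μ n) m) + (T (μ n) m - T ν m) + (T ν m - charFun ν t) := by ring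
  rw [e]
  refine (norm_add₃_le).trans (add_le_add (add_le_add_left ?_ _) ?_)
  · exact norm_charFun_sub_sum_moments_le (hμ n) t m
  · rw [norm_sub_rev]
    exact norm_charFun_sub_sum_moments_le hν t m

/-- Lévy's continuity theorem gives weak convergence; since `ν` has no atoms, every half-line is a
continuity set. -/
theorem tendsto_cdf_of_tendsto_moments {μ : ℕ → Measure ℝ} {ν : Measure ℝ}
    [∀ n, IsProbabilityMeasure (μ n)] [IsProbabilityMeasure ν] [NullSingletonClass ν] {R : ℝ}
    (hμ : ∀ n, ∀ k : ℕ, Integrable (fun x : ℝ => x ^ k) (μ n)) (hR : ∀ᵐ x ∂ν, |x| ≤ R)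
    (h : ∀ k : ℕ, Tendsto (fun n => ∫ x, x ^ k ∂μ n) atTop (𝓝 (∫ x, x ^ k ∂ν))) (x : ℝ) :
    Tendsto (fun n => ProbabilityTheory.cdf (μ n) x) atTop (𝓝 (ProbabilityTheory.cdf ν x)) := by
  let μ' : ℕ → ProbabilityMeasure ℝ := fun n => ⟨μ n, inferInstance⟩
  let ν' : ProbabilityMeasure ℝ := ⟨ν, inferInstance⟩
  have hw : Tendsto μ' atTop (𝓝 ν') :=
    ProbabilityMeasure.tendsto_of_tendsto_charFun (tendsto_charFun_of_tendsto_moments hμ hR h)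
  have := ProbabilityMeasure.tendsto_measure_of_null_frontier_of_tendsto' hw (E := Set.Iic x)
    (by rw [frontier_Iic]; exact measure_singleton (μ := ν) x)
  simp only [ProbabilityTheory.cdf_eq_real]
  exact (ENNReal.tendsto_toReal (measure_ne_top _ _)).comp this

/-! ### Quantile functions -/

namespace ProbabilityTheory

/-- The quantile function of a probability measure on the real line. -/
def quantile (μ : Measure ℝ) (t : ℝ) : ℝ :=
  sInf {x | t ≤ cdf μ x}

variable {μ ν : Measure ℝ}

/-- For `0 < t < 1` the set in `quantile` is non-empty and bounded below, and right continuity of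
the distribution function makes its infimum a minimum. -/
theorem quantile_le_iff {t : ℝ} (ht : t ∈ Set.Ioo (0 : ℝ) 1) {x : ℝ} :
    quantile μ t ≤ x ↔ t ≤ cdf μ x := by
  obtain ⟨b, hb⟩ := ((tendsto_cdf_atBot μ).eventually (gt_mem_nhds ht.1)).exists
  obtain ⟨a, ha⟩ := ((tendsto_cdf_atTop μ).eventually (lt_mem_nhds ht.2)).exists
  have hbdd : BddBelow {x | t ≤ cdf μ x} := by
    refine ⟨b, fun y hy => le_of_not_gt fun hlt => ?_⟩
    exact absurd (hy.trans (monotone_cdf μ hlt.le)) (not_le.2 hb)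
  constructor
  · intro h
    refine le_trans ?_ (monotone_cdf μ h)
    refine ge_of_tendsto (((cdf μ).right_continuous (quantile μ t)).mono_left
      (nhdsWithin_mono _ Set.Ioi_subset_Ici_self)) ?_
    filter_upwards [self_mem_nhdsWithin] with y hy
    obtain ⟨z, hz, hzy⟩ := exists_lt_of_csInf_lt ⟨a, ha.le⟩ hy
    exact le_trans hz (monotone_cdf μ hzy.le)
  · exact fun h => csInf_le hbdd h

theorem monotoneOn_quantile : MonotoneOn (quantile μ) (Set.Ioo 0 1) := fun _ hs _ ht hst =>
  (quantile_le_iff hs).2 (hst.trans ((quantile_le_iff ht).1 le_rfl))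

theorem aemeasurable_quantile :
    AEMeasurable (quantile μ) (volume.restrict (Set.Ioo (0 : ℝ) 1)) :=
  aemeasurable_restrict_of_monotoneOn measurableSet_Ioo monotoneOn_quantile

theorem map_quantile [IsProbabilityMeasure μ] :
    (volume.restrict (Set.Ioo (0 : ℝ) 1)).map (quantile μ) = μ := by
  have : IsFiniteMeasure ((volume.restrict (Set.Ioo (0 : ℝ) 1)).map (quantile μ)) :=
    inferInstance
  refine Measure.ext_of_Iic _ _ fun x => ?_
  rw [Measure.map_apply_of_aemeasurable aemeasurable_quantile measurableSet_Iic,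
    Measure.restrict_apply' measurableSet_Ioo, ← ofReal_cdf]
  have h : quantile μ ⁻¹' Set.Iic x ∩ Set.Ioo 0 1 = Set.Iic (cdf μ x) ∩ Set.Ioo 0 1 := by
    ext t
    simp only [Set.mem_inter_iff, Set.mem_preimage, Set.mem_Iic]
    exact and_congr_left fun ht => quantile_le_iff ht
  rw [h]
  refine le_antisymm ?_ ?_
  · calc volume (Set.Iic (cdf μ x) ∩ Set.Ioo 0 1) ≤ volume (Set.Ioc 0 (cdf μ x)) := by
          refine measure_mono fun t ht => ?_
          exact ⟨ht.2.1, ht.1⟩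
      _ = _ := by simp
  · calc ENNReal.ofReal (cdf μ x) = volume (Set.Ioo 0 (cdf μ x)) := by simp
      _ ≤ _ := by
        refine measure_mono fun t ht => ?_
        exact ⟨ht.2.le, ht.1, ht.2.trans_le (cdf_le_one μ x)⟩

/-- Convergence holds wherever the limit quantile is continuous, and a monotone function has only
countably many discontinuities. -/
theorem tendsto_quantile {μ : ℕ → Measure ℝ}
    (h : ∀ x, Tendsto (fun n => cdf (μ n) x) atTop (𝓝 (cdf ν x))) :
    ∀ᵐ t ∂volume.restrict (Set.Ioo (0 : ℝ) 1),
      Tendsto (fun n => quantile (μ n) t) atTop (𝓝 (quantile ν t)) := by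
  have hc := (monotoneOn_quantile (μ := ν)).countable_not_continuousWithinAt
  have hae : ∀ᵐ t : ℝ, t ∉ {x | x ∈ Set.Ioo (0 : ℝ) 1 ∧
      ¬ContinuousWithinAt (quantile ν) (Set.Ioo 0 1) x} := hc.ae_notMem _
  filter_upwards [ae_restrict_mem measurableSet_Ioo, ae_restrict_of_ae hae] with t ht htc
  have hcont : ContinuousAt (quantile ν) t := by
    have h1 : ContinuousWithinAt (quantile ν) (Set.Ioo 0 1) t := by
      by_contra hn
      exact htc ⟨ht, hn⟩
    exact h1.continuousAt (isOpen_Ioo.mem_nhds ht)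
  rw [tendsto_order]
  constructor
  · intro a ha
    have h1 : cdf ν a < t := by
      rw [← not_le, ← quantile_le_iff ht, not_le]
      exact ha
    filter_upwards [(h a).eventually (gt_mem_nhds h1)] with n hn
    rw [← not_le, quantile_le_iff ht, not_le]
    exact hn
  · intro b hb
    obtain ⟨b', hb', hbb⟩ := exists_between hb
    -- A point `s > t` is needed to obtain the strict inequality `t < cdf ν b'`, which persists for
    -- large `n`.
    have h1 : ∀ᶠ s in 𝓝[>] t, quantile ν s < b' ∧ s ∈ Set.Ioo (0 : ℝ) 1 :=
      nhdsWithin_le_nhds ((hcont.eventually (gt_mem_nhds hb')).and (isOpen_Ioo.mem_nhds ht))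
    obtain ⟨s, ⟨hs, hs1⟩, hts⟩ := (h1.and self_mem_nhdsWithin).exists
    have h2 : t < cdf ν b' := lt_of_lt_of_le hts ((quantile_le_iff hs1).1 hs.le)
    filter_upwards [(h b').eventually (lt_mem_nhds h2)] with n hn
    exact ((quantile_le_iff ht).2 hn.le).trans_lt hbb

end ProbabilityTheory

/-! ### Wasserstein convergence and convergence of moments -/

theorem coupling_isProbabilityMeasure {μ ν : Measure ℝ} [IsProbabilityMeasure μ]
    {γ : Measure (ℝ × ℝ)} (hγ : γ ∈ couplings μ ν) : IsProbabilityMeasure γ := by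
  constructor
  have h := congrArg (fun m => m Set.univ) hγ.1
  simpa [Measure.map_apply measurable_fst MeasurableSet.univ] using h

/-- Both quantile functions on the common space `(0, 1)` form a coupling; its optimality is not
needed. -/
theorem wassersteinDist_quantile_le (p : ℝ) (μ ν : Measure ℝ) [IsProbabilityMeasure μ]
    [IsProbabilityMeasure ν] :
    wassersteinDist p μ ν ≤ (∫⁻ t in Set.Ioo (0 : ℝ) 1,
      ‖ProbabilityTheory.quantile μ t - ProbabilityTheory.quantile ν t‖ₑ ^ p) ^ (1 / p) := by
  have hμ := ProbabilityTheory.aemeasurable_quantile (μ := μ)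
  have hν := ProbabilityTheory.aemeasurable_quantile (μ := ν)
  have hmem : (volume.restrict (Set.Ioo (0 : ℝ) 1)).map (fun t =>
      (ProbabilityTheory.quantile μ t, ProbabilityTheory.quantile ν t)) ∈ couplings μ ν := by
    constructor
    · rw [AEMeasurable.map_map_of_aemeasurable measurable_fst.aemeasurable (hμ.prodMk hν)]
      exact ProbabilityTheory.map_quantile
    · rw [AEMeasurable.map_map_of_aemeasurable measurable_snd.aemeasurable (hμ.prodMk hν)]
      exact ProbabilityTheory.map_quantile
  refine (iInf₂_le _ hmem).trans_eq ?_
  rw [lintegral_map' (by fun_prop) (hμ.prodMk hν)]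

/-- Truncation at `K`: the bounded part suits dominated convergence, and the tail is controlled by a
moment of order `p + 1`. -/
theorem ENNReal.rpow_le_min_rpow_add {p : ℝ} (hp : 0 ≤ p) (d : ℝ≥0∞) {K : ℝ≥0∞} (hK : K ≠ 0)
    (hK' : K ≠ ∞) : d ^ p ≤ min d K ^ p + K⁻¹ * d ^ (p + 1) := by
  rcases le_total d K with h | h
  · rw [min_eq_left h]
    exact le_self_add
  · refine le_trans ?_ le_add_self
    rw [ENNReal.rpow_add_of_nonneg _ _ hp zero_le_one, ENNReal.rpow_one, mul_comm (d ^ p),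
      ← mul_assoc]
    refine le_mul_of_one_le_left' ?_
    rw [← ENNReal.inv_mul_cancel hK hK']
    gcongr

/-- Convergence of the distribution functions and bounded moments of higher order imply
convergence in the Wasserstein distance. -/
theorem tendsto_wassersteinDist_of_tendsto_cdf {p : ℝ} (hp : 1 ≤ p) {μ : ℕ → Measure ℝ}
    {ν : Measure ℝ} [∀ n, IsProbabilityMeasure (μ n)] [IsProbabilityMeasure ν]
    (h : ∀ x, Tendsto (fun n => ProbabilityTheory.cdf (μ n) x) atTop
      (𝓝 (ProbabilityTheory.cdf ν x)))
    {C : ℝ≥0∞} (hC : C ≠ ∞) (hμ : ∀ n, ∫⁻ x, ‖x‖ₑ ^ (p + 1) ∂μ n ≤ C)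
    (hν : ∫⁻ x, ‖x‖ₑ ^ (p + 1) ∂ν ≤ C) :
    Tendsto (fun n => wassersteinDist p (μ n) ν) atTop (𝓝 0) := by
  set lam : Measure ℝ := volume.restrict (Set.Ioo (0 : ℝ) 1) with hlam
  have : IsProbabilityMeasure lam := ⟨by simp [hlam]⟩
  have hp0 : 0 < p := by linarith
  let d : ℕ → ℝ → ℝ≥0∞ := fun n t =>
    ‖ProbabilityTheory.quantile (μ n) t - ProbabilityTheory.quantile ν t‖ₑ
  have hd : ∀ n, AEMeasurable (d n) lam := fun n =>
    (ProbabilityTheory.aemeasurable_quantile.sub ProbabilityTheory.aemeasurable_quantile).enorm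
  have hmom : ∀ (ρ : Measure ℝ) [IsProbabilityMeasure ρ],
      ∫⁻ t, ‖ProbabilityTheory.quantile ρ t‖ₑ ^ (p + 1) ∂lam = ∫⁻ x, ‖x‖ₑ ^ (p + 1) ∂ρ := by
    intro ρ _
    conv_rhs => rw [← ProbabilityTheory.map_quantile (μ := ρ)]
    rw [lintegral_map' (by fun_prop) ProbabilityTheory.aemeasurable_quantile]
  set C' : ℝ≥0∞ := 2 ^ p * (C + C) with hC'
  have hC'top : C' ≠ ∞ := by
    refine ENNReal.mul_ne_top (ENNReal.rpow_ne_top_of_nonneg hp0.le (by simp)) ?_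
    exact ENNReal.add_ne_top.2 ⟨hC, hC⟩
  have hdmom : ∀ n, ∫⁻ t, d n t ^ (p + 1) ∂lam ≤ C' := by
    intro n
    calc ∫⁻ t, d n t ^ (p + 1) ∂lam
        ≤ ∫⁻ t, 2 ^ p * (‖ProbabilityTheory.quantile (μ n) t‖ₑ ^ (p + 1)
            + ‖ProbabilityTheory.quantile ν t‖ₑ ^ (p + 1)) ∂lam := by
          refine lintegral_mono fun t => ?_
          refine (ENNReal.rpow_le_rpow enorm_sub_le (by linarith)).trans ?_
          simpa using ENNReal.rpow_add_le_mul_rpow_add_rpow _ _ (by linarith : 1 ≤ p + 1)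
      _ ≤ C' := by
          rw [lintegral_const_mul' _ _ (ENNReal.rpow_ne_top_of_nonneg hp0.le (by simp)),
            lintegral_add_left' (ProbabilityTheory.aemeasurable_quantile.enorm.pow_const _),
            hmom, hmom, hC']
          gcongr
          exact hμ n
  have hmain : Tendsto (fun n => ∫⁻ t, d n t ^ p ∂lam) atTop (𝓝 0) := by
    rw [ENNReal.tendsto_nhds_zero]
    intro ε hε
    -- This truncation level makes the tail small uniformly in `n`.
    obtain ⟨K, hK0, hKtop, hK⟩ : ∃ K : ℝ≥0∞, K ≠ 0 ∧ K ≠ ∞ ∧ K⁻¹ * C' ≤ ε / 2 := by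
      have ht : Tendsto (fun k : ℕ => ((k : ℝ≥0∞))⁻¹ * C') atTop (𝓝 (0 * C')) :=
        ENNReal.Tendsto.mul_const ENNReal.tendsto_inv_nat_nhds_zero (Or.inr hC'top)
      rw [zero_mul] at ht
      obtain ⟨k, hk, hk1⟩ := (((ENNReal.tendsto_nhds_zero.1 ht) (ε / 2)
        (ENNReal.half_pos hε.ne')).and (eventually_ge_atTop 1)).exists
      exact ⟨k, by exact_mod_cast (by omega : k ≠ 0), ENNReal.natCast_ne_top k, hk⟩
    have hdct : Tendsto (fun n => ∫⁻ t, min (d n t) K ^ p ∂lam) atTop (𝓝 (∫⁻ _, 0 ∂lam)) := by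
      refine tendsto_lintegral_of_dominated_convergence' (fun _ => K ^ p)
        (fun n => ((hd n).min aemeasurable_const).pow_const p)
        (fun n => ae_of_all _ fun t => ENNReal.rpow_le_rpow (min_le_right _ _) hp0.le) ?_ ?_
      · simpa using ENNReal.rpow_ne_top_of_nonneg hp0.le hKtop
      · filter_upwards [ProbabilityTheory.tendsto_quantile h] with t ht
        have h1 : Tendsto (fun n => d n t) atTop (𝓝 0) := by
          simpa using (ht.sub_const (ProbabilityTheory.quantile ν t)).enorm
        have h2 : Tendsto (fun n => min (d n t) K) atTop (𝓝 0) :=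
          tendsto_of_tendsto_of_tendsto_of_le_of_le tendsto_const_nhds h1 (fun _ => zero_le)
            fun n => min_le_left _ _
        have h3 := ((ENNReal.continuous_rpow_const (y := p)).tendsto 0).comp h2
        rwa [ENNReal.zero_rpow_of_pos hp0] at h3
    rw [lintegral_zero] at hdct
    filter_upwards [(ENNReal.tendsto_nhds_zero.1 hdct) (ε / 2) (ENNReal.half_pos hε.ne')]
      with n hn
    calc ∫⁻ t, d n t ^ p ∂lam
        ≤ ∫⁻ t, (min (d n t) K ^ p + K⁻¹ * d n t ^ (p + 1)) ∂lam :=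
          lintegral_mono fun t => ENNReal.rpow_le_min_rpow_add hp0.le _ hK0 hKtop
      _ = ∫⁻ t, min (d n t) K ^ p ∂lam + K⁻¹ * ∫⁻ t, d n t ^ (p + 1) ∂lam := by
          rw [lintegral_add_left' (((hd n).min aemeasurable_const).pow_const p),
            lintegral_const_mul' _ _ (ENNReal.inv_ne_top.2 hK0)]
      _ ≤ ε / 2 + ε / 2 := add_le_add hn (le_trans (by gcongr; exact hdmom n) hK)
      _ = ε := ENNReal.add_halves ε
  have hroot := ((ENNReal.continuous_rpow_const (y := 1 / p)).tendsto 0).comp hmain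
  rw [ENNReal.zero_rpow_of_pos (by positivity)] at hroot
  exact tendsto_of_tendsto_of_tendsto_of_le_of_le tendsto_const_nhds hroot (fun _ => zero_le)
    fun n => wassersteinDist_quantile_le p (μ n) ν

theorem integrable_pow_of_mem_wassersteinSpace {μ : Measure ℝ}
    (h : ∀ p : ℝ, 1 ≤ p → μ ∈ wassersteinSpace p) (k : ℕ) :
    Integrable (fun x : ℝ => x ^ k) μ := by
  have : IsProbabilityMeasure μ := (h 1 le_rfl).1
  rcases Nat.eq_zero_or_pos k with rfl | hk
  · simp
  · refine ⟨by fun_prop, ?_⟩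
    have h1 := (h k (by exact_mod_cast hk)).2
    simpa [HasFiniteIntegral, enorm_pow] using h1

theorem lintegral_enorm_rpow_le {μ : Measure ℝ} [IsProbabilityMeasure μ] {r : ℝ} (hr : 0 ≤ r)
    {m : ℕ} (hm : r ≤ 2 * m) (hμ : Integrable (fun x : ℝ => x ^ (2 * m)) μ) :
    ∫⁻ x, ‖x‖ₑ ^ r ∂μ ≤ 1 + ENNReal.ofReal (∫ x, x ^ (2 * m) ∂μ) := by
  have h0 : ∀ x : ℝ, 0 ≤ x ^ (2 * m) := fun x => (even_two_mul m).pow_nonneg x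
  rw [ofReal_integral_eq_lintegral_ofReal hμ (ae_of_all _ h0)]
  calc ∫⁻ x, ‖x‖ₑ ^ r ∂μ ≤ ∫⁻ x, (1 + ENNReal.ofReal (x ^ (2 * m))) ∂μ := by
        refine lintegral_mono fun x => ?_
        rcases le_total ‖x‖ₑ 1 with hx | hx
        · exact (ENNReal.rpow_le_one hx hr).trans le_self_add
        · refine le_trans ?_ le_add_self
          refine (ENNReal.rpow_le_rpow_of_exponent_le hx hm).trans_eq ?_
          rw [← Real.enorm_of_nonneg (h0 x), enorm_pow, ← ENNReal.rpow_natCast]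
          push_cast
          rfl
    _ = _ := by
        rw [lintegral_add_left measurable_const]
        simp

/-- For a limit of bounded support without atoms, convergence of the moments implies convergence
in all Wasserstein distances. -/
theorem convergesInWasserstein_of_tendsto_moments {μ : ℕ → Measure ℝ} {ν : Measure ℝ}
    [NullSingletonClass ν] {R : ℝ} (hμ : ∀ n, ∀ p : ℝ, 1 ≤ p → μ n ∈ wassersteinSpace p)
    (hν : ∀ p : ℝ, 1 ≤ p → ν ∈ wassersteinSpace p) (hR : ∀ᵐ x ∂ν, |x| ≤ R)
    (h : ∀ k : ℕ, Tendsto (fun n => ∫ x, x ^ k ∂μ n) atTop (𝓝 (∫ x, x ^ k ∂ν)))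
    {p : ℝ} (hp : 1 ≤ p) : ConvergesInWasserstein p μ ν := by
  have : ∀ n, IsProbabilityMeasure (μ n) := fun n => (hμ n 1 le_rfl).1
  have : IsProbabilityMeasure ν := (hν 1 le_rfl).1
  refine ⟨fun n => hμ n p hp, hν p hp, ?_⟩
  have hint := fun n => integrable_pow_of_mem_wassersteinSpace (hμ n)
  obtain ⟨m, hm⟩ := exists_nat_ge (p + 1)
  have hm' : p + 1 ≤ 2 * (m : ℝ) := by linarith
  obtain ⟨B, hB⟩ := (h (2 * m)).bddAbove_range
  refine tendsto_wassersteinDist_of_tendsto_cdf hp (tendsto_cdf_of_tendsto_moments hint hR h)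
    (C := (1 + ENNReal.ofReal B) + ∫⁻ x, ‖x‖ₑ ^ (p + 1) ∂ν) ?_ (fun n => ?_) le_add_self
  · exact ENNReal.add_ne_top.2 ⟨by simp, (hν (p + 1) (by linarith)).2.ne⟩
  · refine (lintegral_enorm_rpow_le (by linarith) hm' (hint n _)).trans ?_
    refine le_trans ?_ le_self_add
    gcongr
    exact hB ⟨n, rfl⟩

/-- For `|x - y| ≤ η` the mean value bound is of order `η`; otherwise `R ≤ (R / η) * |x - y|`, so
the same bound is absorbed by `|x - y| ^ k`. Thus the cost of `W_k` alone controls the `k`-th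
moment. -/
theorem abs_pow_sub_pow_le_add {R η x y : ℝ} (hη : 0 < η) (hη1 : η ≤ 1) (hy : |y| ≤ R) {k : ℕ}
    (hk : 1 ≤ k) :
    |x ^ k - y ^ k| ≤ k * (R + 1) ^ (k - 1) * η + k * (R / η + 1) ^ (k - 1) * |x - y| ^ k := by
  have hR : 0 ≤ R := (abs_nonneg y).trans hy
  have hmax : max |x| |y| ≤ R + |x - y| := by
    have h1 : |x| ≤ |x - y| + |y| := by simpa using abs_add_le (x - y) y
    exact max_le (by linarith) (by linarith [abs_nonneg (x - y)])
  have h0 : |x ^ k - y ^ k| ≤ |x - y| * k * (R + |x - y|) ^ (k - 1) := by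
    refine (abs_pow_sub_pow_le x y k).trans ?_
    gcongr
  have hd := abs_nonneg (x - y)
  rcases le_total |x - y| η with h | h
  · have h1 : |x - y| * k * (R + |x - y|) ^ (k - 1) ≤ η * k * (R + 1) ^ (k - 1) := by
      gcongr
      linarith
    have h2 : 0 ≤ k * (R / η + 1) ^ (k - 1) * |x - y| ^ k := by positivity
    linarith
  · have h1 : R + |x - y| ≤ (R / η + 1) * |x - y| := by
      have : R / η * η ≤ R / η * |x - y| := by gcongr
      rw [div_mul_cancel₀ _ hη.ne'] at this
      linarith
    have h2 : |x - y| * k * (R + |x - y|) ^ (k - 1)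
        ≤ |x - y| * k * ((R / η + 1) * |x - y|) ^ (k - 1) := by gcongr
    have h3 : |x - y| * k * ((R / η + 1) * |x - y|) ^ (k - 1)
        = k * (R / η + 1) ^ (k - 1) * |x - y| ^ k := by
      obtain ⟨j, rfl⟩ : ∃ j, k = j + 1 := ⟨k - 1, by omega⟩
      rw [Nat.add_sub_cancel, mul_pow, pow_succ |x - y|]
      ring
    have h4 : 0 ≤ k * (R + 1) ^ (k - 1) * η := by positivity
    linarith

theorem enorm_moment_sub_le_of_coupling {μ ν : Measure ℝ} [IsProbabilityMeasure μ] {R η : ℝ}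
    (hη : 0 < η) (hη1 : η ≤ 1) (hR : ∀ᵐ x ∂ν, |x| ≤ R) {k : ℕ} (hk : 1 ≤ k)
    (hμ : Integrable (fun x : ℝ => x ^ k) μ) (hν : Integrable (fun x : ℝ => x ^ k) ν)
    {γ : Measure (ℝ × ℝ)} (hγ : γ ∈ couplings μ ν) :
    ‖∫ x, x ^ k ∂μ - ∫ x, x ^ k ∂ν‖ₑ ≤ ENNReal.ofReal (k * (R + 1) ^ (k - 1) * η)
      + ENNReal.ofReal (k * (R / η + 1) ^ (k - 1)) * ∫⁻ z, ‖z.1 - z.2‖ₑ ^ (k : ℝ) ∂γ := by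
  have := coupling_isProbabilityMeasure hγ
  obtain ⟨h1, h2⟩ := hγ
  subst h1 h2
  replace hμ : Integrable (fun z : ℝ × ℝ => z.1 ^ k) γ := hμ.comp_measurable measurable_fst
  replace hν : Integrable (fun z : ℝ × ℝ => z.2 ^ k) γ := hν.comp_measurable measurable_snd
  rw [integral_map (by fun_prop) (by fun_prop), integral_map (by fun_prop) (by fun_prop),
    ← integral_sub hμ hν]
  refine (enorm_integral_le_lintegral_enorm _).trans ?_
  have hR' : ∀ᵐ z ∂γ, |z.2| ≤ R := ae_of_ae_map (by fun_prop) hR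
  calc ∫⁻ z, ‖z.1 ^ k - z.2 ^ k‖ₑ ∂γ
      ≤ ∫⁻ z, (ENNReal.ofReal (k * (R + 1) ^ (k - 1) * η)
        + ENNReal.ofReal (k * (R / η + 1) ^ (k - 1)) * ‖z.1 - z.2‖ₑ ^ (k : ℝ)) ∂γ := by
        refine lintegral_mono_ae ?_
        filter_upwards [hR'] with z hz
        have hR0 : 0 ≤ R := (abs_nonneg _).trans hz
        rw [ENNReal.rpow_natCast, ← enorm_pow, Real.enorm_eq_ofReal_abs, Real.enorm_eq_ofReal_abs,
          abs_pow, ← ENNReal.ofReal_mul (by positivity),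
          ← ENNReal.ofReal_add (by positivity) (by positivity)]
        exact ENNReal.ofReal_le_ofReal (abs_pow_sub_pow_le_add hη hη1 hz hk)
    _ = _ := by
        rw [lintegral_add_left measurable_const, lintegral_const_mul _ (by fun_prop)]
        simp

/-- Convergence in all Wasserstein distances to a limit of bounded support implies convergence of
the moments. -/
theorem tendsto_moments_of_convergesInWasserstein {μ : ℕ → Measure ℝ} {ν : Measure ℝ} {R : ℝ}
    (hR : ∀ᵐ x ∂ν, |x| ≤ R) (h : ∀ p : ℝ, 1 ≤ p → ConvergesInWasserstein p μ ν) (k : ℕ) :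
    Tendsto (fun n => ∫ x, x ^ k ∂μ n) atTop (𝓝 (∫ x, x ^ k ∂ν)) := by
  have : ∀ n, IsProbabilityMeasure (μ n) := fun n => ((h 1 le_rfl).1 n).1
  have : IsProbabilityMeasure ν := (h 1 le_rfl).2.1.1
  rcases Nat.eq_zero_or_pos k with rfl | hk
  · simp
  have hμ := fun n => integrable_pow_of_mem_wassersteinSpace (fun p hp => (h p hp).1 n)
  have hν := integrable_pow_of_mem_wassersteinSpace (fun p hp => (h p hp).2.1)
  have hR0 : 0 ≤ R := by
    obtain ⟨x, hx⟩ := hR.exists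
    exact (abs_nonneg x).trans hx
  have hk0 : (0 : ℝ) < k := by exact_mod_cast hk
  have hW := (h k (by exact_mod_cast hk)).2.2
  rw [tendsto_iff_edist_tendsto_0, ENNReal.tendsto_nhds_zero]
  intro ε hε
  obtain ⟨η, hη, hη1, hηε⟩ : ∃ η : ℝ, 0 < η ∧ η ≤ 1 ∧
      ENNReal.ofReal (k * (R + 1) ^ (k - 1) * η) ≤ ε / 2 := by
    have ht : Tendsto (fun η : ℝ => ENNReal.ofReal (k * (R + 1) ^ (k - 1) * η)) (𝓝[>] 0)
        (𝓝 0) := by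
      have : Continuous fun η : ℝ => ENNReal.ofReal (k * (R + 1) ^ (k - 1) * η) :=
        ENNReal.continuous_ofReal.comp (by fun_prop)
      have h0 := (this.tendsto 0).mono_left (nhdsWithin_le_nhds (s := Set.Ioi 0))
      simpa using h0
    obtain ⟨η, h1, h2⟩ := (((ENNReal.tendsto_nhds_zero.1 ht) (ε / 2)
      (ENNReal.half_pos hε.ne')).and (Ioo_mem_nhdsGT zero_lt_one)).exists
    exact ⟨η, h2.1, h2.2.le, h1⟩
  -- `B` blows up as `η → 0`, so the distance `δ` is chosen only after `η`.
  set B : ℝ≥0∞ := ENNReal.ofReal (k * (R / η + 1) ^ (k - 1)) with hB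
  obtain ⟨δ, hδ, hδε⟩ : ∃ δ : ℝ≥0∞, 0 < δ ∧ B * δ ^ (k : ℝ) ≤ ε / 2 := by
    have ht : Tendsto (fun j : ℕ => B * ((j : ℝ≥0∞)⁻¹) ^ (k : ℝ)) atTop (𝓝 0) := by
      have h1 := ((ENNReal.continuous_rpow_const (y := (k : ℝ))).tendsto 0).comp
        ENNReal.tendsto_inv_nat_nhds_zero
      rw [ENNReal.zero_rpow_of_pos hk0] at h1
      simpa using ENNReal.Tendsto.const_mul h1 (Or.inr (ENNReal.ofReal_ne_top (r := _)))
    obtain ⟨j, hj⟩ := ((ENNReal.tendsto_nhds_zero.1 ht) (ε / 2)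
      (ENNReal.half_pos hε.ne')).exists
    exact ⟨(j : ℝ≥0∞)⁻¹, ENNReal.inv_pos.2 (ENNReal.natCast_ne_top j), hj⟩
  filter_upwards [hW.eventually (gt_mem_nhds hδ)] with n hn
  simp only [wassersteinDist, iInf_lt_iff] at hn
  obtain ⟨γ, hγ, hlt⟩ := hn
  have hI : ∫⁻ z, ‖z.1 - z.2‖ₑ ^ (k : ℝ) ∂γ ≤ δ ^ (k : ℝ) := by
    have := ENNReal.rpow_le_rpow hlt.le hk0.le
    rwa [← ENNReal.rpow_mul, one_div, inv_mul_cancel₀ hk0.ne', ENNReal.rpow_one] at this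
  rw [edist_eq_enorm_sub]
  calc _ ≤ _ := enorm_moment_sub_le_of_coupling hη hη1 hR hk (hμ n k) (hν k) hγ
    _ ≤ ε / 2 + ε / 2 := add_le_add hηε (le_trans (by gcongr) hδε)
    _ = ε := ENNReal.add_halves ε

section

open Polynomial

/-! ### The semicircle law -/

theorem measurable_semicircleDensity : Measurable fun x : ℝ =>
    ENNReal.ofReal (if |x| ≤ 2 then 1 / (2 * Real.pi) * Real.sqrt (4 - x ^ 2) else 0) := by
  refine Measurable.ennreal_ofReal (Measurable.ite ?_ (by fun_prop) measurable_const)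
  exact measurableSet_le (by fun_prop) measurable_const

theorem ae_abs_le_semicircleLaw : ∀ᵐ x ∂semicircleLaw, |x| ≤ 2 := by
  rw [semicircleLaw, ae_withDensity_iff measurable_semicircleDensity]
  refine ae_of_all _ fun x hx => ?_
  by_contra h
  simp [h] at hx

instance nullSingletonClass_semicircleLaw : NullSingletonClass semicircleLaw :=
  ⟨fun x => withDensity_absolutelyContinuous _ _ (measure_singleton x)⟩

theorem integral_semicircleLaw (g : ℝ → ℝ) :
    ∫ x, g x ∂semicircleLaw
      = ∫ x in (-2 : ℝ)..2, 1 / (2 * Real.pi) * Real.sqrt (4 - x ^ 2) * g x := by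
  rw [semicircleLaw, integral_withDensity_eq_integral_toReal_smul measurable_semicircleDensity
      (ae_of_all _ fun x => ENNReal.ofReal_lt_top),
    intervalIntegral.integral_of_le (by norm_num), ← integral_Icc_eq_integral_Ioc,
    ← integral_indicator measurableSet_Icc]
  refine integral_congr_ae (ae_of_all _ fun x => ?_)
  have hpos : 0 ≤ 1 / (2 * Real.pi) * Real.sqrt (4 - x ^ 2) := by positivity
  by_cases hx : |x| ≤ 2
  · have hx' : x ∈ Set.Icc (-2 : ℝ) 2 := abs_le.1 hx
    rw [Set.indicator_of_mem hx']
    simp only [if_pos hx, smul_eq_mul, ENNReal.toReal_ofReal hpos]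
  · have hx' : x ∉ Set.Icc (-2 : ℝ) 2 := fun h => hx (abs_le.2 h)
    rw [Set.indicator_of_notMem hx']
    simp [hx]

theorem integral_cos_natCast_mul_zero_pi {k : ℕ} (hk : k ≠ 0) :
    ∫ θ in (0 : ℝ)..Real.pi, Real.cos (k * θ) = 0 := by
  rw [intervalIntegral.integral_comp_mul_left _ (by exact_mod_cast hk)]
  simp [Real.sin_nat_mul_pi]

/-- With `x = 2 cos θ` the density and the Jacobian give `sin² θ` up to a constant, so the integrand
becomes a multiple of `sin((k+1)θ) sin θ`, a difference of cosines of non-zero frequencies `k` and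
`k + 2`. -/
theorem integral_chebyshev_S_semicircleLaw {k : ℕ} (hk : k ≠ 0) :
    ∫ x, (Chebyshev.S ℝ k).eval x ∂semicircleLaw = 0 := by
  rw [integral_semicircleLaw]
  have hsub := intervalIntegral.integral_comp_mul_deriv (a := Real.pi) (b := 0)
    (f := fun θ => 2 * Real.cos θ) (f' := fun θ => 2 * -Real.sin θ)
    (g := fun x => 1 / (2 * Real.pi) * Real.sqrt (4 - x ^ 2) * (Chebyshev.S ℝ k).eval x)
    (fun θ _ => (Real.hasDerivAt_cos θ).const_mul 2) (by fun_prop) (by fun_prop)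
  rw [Real.cos_pi, Real.cos_zero, mul_neg, mul_one] at hsub
  rw [← hsub, intervalIntegral.integral_symm, neg_eq_zero]
  have hcongr : ∫ θ in (0 : ℝ)..Real.pi, ((fun x => 1 / (2 * Real.pi) * Real.sqrt (4 - x ^ 2)
        * (Chebyshev.S ℝ k).eval x) ∘ fun θ => 2 * Real.cos θ) θ * (2 * -Real.sin θ)
      = ∫ θ in (0 : ℝ)..Real.pi,
        (Real.pi)⁻¹ * (Real.cos ((k + 2 : ℕ) * θ) - Real.cos (k * θ)) := by
    refine intervalIntegral.integral_congr fun θ hθ => ?_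
    rw [Set.uIcc_of_le Real.pi_pos.le] at hθ
    have hsin : 0 ≤ Real.sin θ := Real.sin_nonneg_of_mem_Icc hθ
    have hsqrt : Real.sqrt (4 - (2 * Real.cos θ) ^ 2) = 2 * Real.sin θ := by
      rw [← Real.sqrt_sq (by positivity : 0 ≤ 2 * Real.sin θ)]
      congr 1
      nlinarith [Real.sin_sq_add_cos_sq θ]
    have h1 := Chebyshev.S_two_mul_real_cos θ k
    rw [Int.cast_natCast] at h1
    have h2 : Real.cos ((k + 2 : ℕ) * θ) - Real.cos (k * θ)
        = -2 * (Real.sin ((k + 1) * θ) * Real.sin θ) := by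
      rw [Real.cos_sub_cos]
      push_cast
      ring_nf
    simp only [Function.comp_apply, hsqrt]
    rw [h2, ← h1]
    field_simp
  rw [hcongr, intervalIntegral.integral_const_mul, intervalIntegral.integral_sub
    (Continuous.intervalIntegrable (by fun_prop) _ _)
    (Continuous.intervalIntegrable (by fun_prop) _ _),
    integral_cos_natCast_mul_zero_pi hk, integral_cos_natCast_mul_zero_pi (by omega)]
  simp

/-! ### Integrals of polynomials -/

theorem integrable_polynomial_eval {μ : Measure ℝ}
    (h : ∀ k : ℕ, Integrable (fun x : ℝ => x ^ k) μ) (P : ℝ[X]) :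
    Integrable (fun x => P.eval x) μ := by
  induction P using Polynomial.induction_on' with
  | add p q hp hq => exact (hp.add hq).congr (ae_of_all _ fun x => (eval_add ..).symm)
  | monomial n a => simpa using (h n).const_mul a

theorem tendsto_integral_polynomial_of_tendsto_moments {μ : ℕ → Measure ℝ} {ν : Measure ℝ}
    (hμ : ∀ n, ∀ k : ℕ, Integrable (fun x : ℝ => x ^ k) (μ n))
    (hν : ∀ k : ℕ, Integrable (fun x : ℝ => x ^ k) ν)
    (h : ∀ k : ℕ, Tendsto (fun n => ∫ x, x ^ k ∂μ n) atTop (𝓝 (∫ x, x ^ k ∂ν))) (P : ℝ[X]) :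
    Tendsto (fun n => ∫ x, P.eval x ∂μ n) atTop (𝓝 (∫ x, P.eval x ∂ν)) := by
  induction P using Polynomial.induction_on' with
  | add p q hp hq =>
    simp only [eval_add]
    rw [integral_add (integrable_polynomial_eval hν p) (integrable_polynomial_eval hν q)]
    simpa only [integral_add (integrable_polynomial_eval (hμ _) p)
      (integrable_polynomial_eval (hμ _) q)] using hp.add hq
  | monomial n a =>
    simp only [eval_monomial, integral_const_mul]
    exact (h n).const_mul a

theorem tendsto_moments_of_tendsto_integral_chebyshev {μ : ℕ → Measure ℝ} {ν : Measure ℝ}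
    (hμ : ∀ n, ∀ k : ℕ, Integrable (fun x : ℝ => x ^ k) (μ n))
    (hν : ∀ k : ℕ, Integrable (fun x : ℝ => x ^ k) ν)
    (h : ∀ k : ℕ, Tendsto (fun n => ∫ x, (Chebyshev.S ℝ k).eval x ∂μ n) atTop
      (𝓝 (∫ x, (Chebyshev.S ℝ k).eval x ∂ν))) (m : ℕ) :
    Tendsto (fun n => ∫ x, x ^ m ∂μ n) atTop (𝓝 (∫ x, x ^ m ∂ν)) := by
  -- The induction on `m` uses `X S_k = S_{k+1} + S_{k-1}`. The shifted index includes `S_{-1} = 0`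
  -- as a boundary case; the moment itself is `k = 1`, where `S_0 = 1`.
  suffices H : ∀ m k : ℕ, Tendsto (fun n => ∫ x, (X ^ m * Chebyshev.S ℝ (k - 1)).eval x ∂μ n) atTop
      (𝓝 (∫ x, (X ^ m * Chebyshev.S ℝ (k - 1)).eval x ∂ν)) by
    simpa using H m 1
  intro m
  induction m with
  | zero =>
    rintro (_ | k)
    · simp
    · simpa using h k
  | succ m ih =>
    rintro (_ | k)
    · simp
    · have e : (X ^ (m + 1) * Chebyshev.S ℝ ((k + 1 : ℕ) - 1) : ℝ[X])
          = X ^ m * Chebyshev.S ℝ ((k + 2 : ℕ) - 1) + X ^ m * Chebyshev.S ℝ (k - 1) := by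
        have h1 := Chebyshev.S_add_two ℝ (k - 1)
        push_cast
        ring_nf at h1 ⊢
        rw [h1]
        ring
      rw [e]
      simp only [eval_add]
      rw [integral_add (integrable_polynomial_eval hν _) (integrable_polynomial_eval hν _)]
      simp only [integral_add (integrable_polynomial_eval (hμ _) _)
        (integrable_polynomial_eval (hμ _) _)]
      exact (ih (k + 2)).add (ih k)

/-! ### Spectral measures of colored graphs -/

/-- If polynomials corresponding to non-backtracking walks have smaller integrals against `ρ n`
than against `μ n`, and the moments of `μ n` converge to those of the semicircle law, then so do
the moments of `ρ n`. -/
theorem tendsto_moments_semicircleLaw_of_abs_integral_le {μ ρ : ℕ → Measure ℝ} {q : ℕ → ℕ}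
    [∀ n, IsProbabilityMeasure (μ n)] [∀ n, IsProbabilityMeasure (ρ n)]
    [IsProbabilityMeasure semicircleLaw]
    (hμ : ∀ n, ∀ k : ℕ, Integrable (fun x : ℝ => x ^ k) (μ n))
    (hρ : ∀ n, ∀ k : ℕ, Integrable (fun x : ℝ => x ^ k) (ρ n))
    (hν : ∀ k : ℕ, Integrable (fun x : ℝ => x ^ k) semicircleLaw)
    (h : ∀ n, ∀ k : ℕ,
      |∫ x, (Chebyshev.S ℝ (k + 1) - C (q n : ℝ)⁻¹ * Chebyshev.S ℝ (k - 1)).eval x ∂ρ n|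
        ≤ ∫ x, (Chebyshev.S ℝ (k + 1) - C (q n : ℝ)⁻¹ * Chebyshev.S ℝ (k - 1)).eval x ∂μ n)
    (hlim : ∀ k : ℕ, Tendsto (fun n => ∫ x, x ^ k ∂μ n) atTop (𝓝 (∫ x, x ^ k ∂semicircleLaw)))
    (k : ℕ) :
    Tendsto (fun n => ∫ x, x ^ k ∂ρ n) atTop (𝓝 (∫ x, x ^ k ∂semicircleLaw)) := by
  have hsplit : ∀ (τ : Measure ℝ), (∀ k : ℕ, Integrable (fun x : ℝ => x ^ k) τ) →
      ∀ (k : ℕ) (c : ℝ), ∫ x, (Chebyshev.S ℝ (k + 1) - C c * Chebyshev.S ℝ (k - 1)).eval x ∂τ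
        = ∫ x, (Chebyshev.S ℝ (k + 1)).eval x ∂τ
          - c * ∫ x, (Chebyshev.S ℝ (k - 1)).eval x ∂τ := by
    intro τ hτ k c
    simp only [eval_sub, eval_mul, eval_C]
    rw [integral_sub (integrable_polynomial_eval hτ _)
      ((integrable_polynomial_eval hτ _).const_mul c), integral_const_mul]
  have hM := fun P => tendsto_integral_polynomial_of_tendsto_moments hμ hν hlim P
  have hM0 : ∀ k : ℕ, Tendsto (fun n => ∫ x, (Chebyshev.S ℝ (k + 1)).eval x ∂μ n) atTop (𝓝 0) := by
    intro k
    have := hM (Chebyshev.S ℝ (k + 1 : ℕ))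
    rw [integral_chebyshev_S_semicircleLaw k.succ_ne_zero] at this
    exact_mod_cast this
  -- The case `k = 1` of `h` makes `∫ S_2 dμ_n - q_n⁻¹` non-negative, as `S_0 = 1`.
  have hq : Tendsto (fun n => (q n : ℝ)⁻¹) atTop (𝓝 0) := by
    refine tendsto_of_tendsto_of_tendsto_of_le_of_le tendsto_const_nhds (hM0 1)
      (fun n => by positivity) fun n => ?_
    have h1 := (abs_nonneg _).trans (h n 1)
    rw [hsplit _ (hμ n)] at h1
    simpa using h1
  have hf : ∀ k : ℕ, Tendsto (fun n => ∫ x, (Chebyshev.S ℝ (k + 1)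
      - C (q n : ℝ)⁻¹ * Chebyshev.S ℝ (k - 1)).eval x ∂ρ n) atTop (𝓝 0) := by
    intro k
    refine squeeze_zero_norm (fun n => h n k) ?_
    simp only [fun n => hsplit _ (hμ n) k]
    simpa using (hM0 k).sub (hq.mul (hM (Chebyshev.S ℝ (k - 1))))
  refine tendsto_moments_of_tendsto_integral_chebyshev hρ hν (fun k => ?_) k
  -- `S_{k+2}` is the walk polynomial plus `q_n⁻¹ S_k`; the integral of `S_k` converges, so the last
  -- term vanishes in the limit.
  induction k using Nat.twoStepInduction with
  | zero => simp
  | one =>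
    rw [integral_chebyshev_S_semicircleLaw one_ne_zero]
    simpa using hf 0
  | more k ih _ =>
    rw [integral_chebyshev_S_semicircleLaw (by omega)]
    have h1 := (hf (k + 1)).add (hq.mul ih)
    simp only [fun n => hsplit _ (hρ n) (k + 1)] at h1
    push_cast at h1 ⊢
    simpa [add_assoc, one_add_one_eq_two] using h1

end

end

/-! ### The equivalence -/

theorem corollary4p2 {V D : ℕ → Type*} [∀ n, Fintype (V n)] [∀ n, DecidableEq (V n)]
    [∀ n, Nonempty (V n)] [∀ n, Fintype (D n)]
    (G : ∀ n, DirectedEdgeGraph (V n) (D n))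
    (q : ℕ → ℕ) (hq : ∀ n, 1 ≤ q n) (hG : ∀ n, (G n).IsRegular (q n + 1))
    (N : ℕ → ℕ) (hN : ∀ n, 1 ≤ N n)
    (H : ∀ n, Subgroup (Matrix.unitaryGroup (Fin (N n)) ℂ)) :
    (∀ p : ℝ, 1 ≤ p →
      ConvergesInWasserstein p (fun n => (G n).spectralMeasure (q n)) semicircleLaw) ↔
    ∀ σ : ∀ n, (G n).Color (H n), ∀ p : ℝ, 1 ≤ p →
      ConvergesInWasserstein p (fun n => (G n).colorSpectralMeasure (q n) (σ n))
        semicircleLaw := by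
  classical
  have : ∀ n, Nonempty (Fin (N n)) := fun n => ⟨⟨0, hN n⟩⟩
  have hμ : ∀ n, ∀ p : ℝ, 1 ≤ p → (G n).spectralMeasure (q n) ∈ wassersteinSpace p :=
    fun n p hp => empiricalSpectralMeasure_mem_wassersteinSpace _ _ hp
  have hρ : ∀ σ : ∀ n, (G n).Color (H n), ∀ n, ∀ p : ℝ, 1 ≤ p →
      (G n).colorSpectralMeasure (q n) (σ n) ∈ wassersteinSpace p :=
    fun σ n p hp => empiricalSpectralMeasure_mem_wassersteinSpace _ _ hp
  constructor
  · intro h σ p hp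
    -- That the semicircle law is a probability measure with finite moments is part of the assumed
    -- convergence, so no integral has to be computed for it.
    have hν : ∀ p : ℝ, 1 ≤ p → semicircleLaw ∈ wassersteinSpace p := fun p hp => (h p hp).2.1
    have := fun n => (hμ n 1 le_rfl).1
    have := fun n => (hρ σ n 1 le_rfl).1
    have := (hν 1 le_rfl).1
    refine convergesInWasserstein_of_tendsto_moments (hρ σ) hν ae_abs_le_semicircleLaw ?_ hp
    exact tendsto_moments_semicircleLaw_of_abs_integral_le
      (fun n => integrable_pow_of_mem_wassersteinSpace (hμ n))
      (fun n => integrable_pow_of_mem_wassersteinSpace (hρ σ n))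
      (integrable_pow_of_mem_wassersteinSpace hν)
      (fun n => (G n).abs_integral_colorSpectralMeasure_le (σ n) (hN n) (hq n) (hG n))
      (tendsto_moments_of_convergesInWasserstein ae_abs_le_semicircleLaw h)
  · intro h p hp
    have h1 := h fun n => (G n).trivialColor (H n)
    refine convergesInWasserstein_of_tendsto_moments hμ (fun p hp => (h1 p hp).2.1)
      ae_abs_le_semicircleLaw (fun k => ?_) hp
    refine (tendsto_moments_of_convergesInWasserstein ae_abs_le_semicircleLaw h1 k).congr
      fun n => ?_
    simpa using (G n).integral_colorSpectralMeasure_trivialColor (H := H n) (hN n) (q n)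
      (Polynomial.X ^ k)
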